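/- Let $d\ge 0$, let $\Omega\subseteq\mathbb R^d$ be open, and let $C^1_0(\Omega,\mathbb R^d)$ be the space of $C^1$ vector fields on $\Omega$ that vanish on $\partial\Omega$ and at infinity, with norm $|v|_{1,\infty}=\sup_{x\in\Omega}\bigl(|v(x)|+\sum_{i=1}^d|\nabla v^i(x)|\bigr)$. Let $\mathcal H$ be an admissible space, i.e. a real Hilbert space of vector fields on $\Omega$ with $\mathcal H\subseteq C^1_0(\Omega,\mathbb R^d)$ for which there is a constant $C>0$ with $|v|_{1,\infty}\le C|v|_{\mathcal H}$ for all $v\in\mathcal H$. Let $I_0,I_1\in L^2(\Omega)$ be real-valued and let $\sigma\neq 0$ be real. For every $u\in L^2([0,1],\mathcal H)$ there is exactly one map $\varphi:[0,1]\times\Omega\to\Omega$, continuous in $t$, that solves $\partial_t\varphi_t=u_t\circ\varphi_t$, $\varphi_0(x)=x$, in the integrated sense $$\varphi_t(x)=x+\int_0^t u_s(\varphi_s(x))\,ds\qquad(t\in[0,1],\ x\in\Omega);$$ its time-one map $\varphi_1:\Omega\to\Omega$ is a bijection, and $I_0\circ\varphi_1^{-1}$ is a well-defined element of $L^2(\Omega)$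 (up to null sets it does not depend on the representative of $I_0$). Moreover the registration energy $$E(u)=\frac12\int_0^1|u_t|_{\mathcal H}^2\,dt+\frac1{2\sigma^2}\,\|I_0\circ\varphi_1^{-1}-I_1\|_{L^2(\Omega)}^2$$ attains its minimum on $L^2([0,1],\mathcal H)$: there is $\tilde u\in L^2([0,1],\mathcal H)$ with $E(\tilde u)=\inf_{u\in L^2([0,1],\mathcal H)}E(u)$. -/

import Mathlib

open MeasureTheory Set Filter Topology

namespace LDDMM

/-- Euclidean space `ℝ^d`, with the Euclidean norm. -/
abbrev Euc (d : ℕ) : Type := EuclideanSpace ℝ (Fin d)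

/-- The space `C¹₀(Ω, ℝ^d)` of `C¹` vector fields on the open set `Ω` that vanish on the boundary
of `Ω` and at infinity. A vector field on `Ω` is represented by its extension by zero to `ℝ^d`;
vanishing on the boundary is then continuity of this extension on all of `ℝ^d`.
(The norm below need not be finite on this space.) -/
def C10 {d : ℕ} (Ω : Set (Euc d)) : Submodule ℝ (Euc d → Euc d) where
  carrier := {v | ContDiffOn ℝ 1 v Ω ∧ (∀ x, x ∉ Ω → v x = 0) ∧ Continuous v ∧
    Tendsto v (cocompact (Euc d)) (𝓝 0)}
  add_mem' := by
    rintro v w ⟨h1, h2, h3, h4⟩ ⟨k1, k2, k3, k4⟩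
    refine ⟨h1.add k1, fun x hx => ?_, h3.add k3, ?_⟩
    · simp [h2 x hx, k2 x hx]
    · have h := h4.add k4
      rw [add_zero] at h
      exact h
  zero_mem' := ⟨contDiffOn_const, fun _ _ => rfl, continuous_const, tendsto_const_nhds⟩
  smul_mem' := by
    rintro c v ⟨h1, h2, h3, h4⟩
    refine ⟨h1.const_smul c, fun x hx => ?_, h3.const_smul c, ?_⟩
    · simp [h2 x hx]
    · have h := h4.const_smul c
      rw [smul_zero] at h
      exact h

/-- The norm `|v|_{1,∞} = sup_{x ∈ Ω} (|v(x)| + ∑ i, |∇vⁱ(x)|)`, with values in `[0, ∞]`. -/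
noncomputable def c1Norm {d : ℕ} (Ω : Set (Euc d)) (v : Euc d → Euc d) : ENNReal :=
  ⨆ x ∈ Ω, (‖v x‖ₑ + ∑ i : Fin d, ‖gradient (𝕜 := ℝ) (fun y => v y i) x‖ₑ)

/-- A real Hilbert space `H`, whose elements are vector fields on `Ω` through the injective linear
map `ι`, is admissible if it is continuously embedded in `C¹₀(Ω, ℝ^d)`:
`|h|_{1,∞} ≤ C |h|_H` for some constant `C > 0`. -/
structure IsAdmissible {d : ℕ} (Ω : Set (Euc d)) {H : Type*} [NormedAddCommGroup H]
    [InnerProductSpace ℝ H] (ι : H →ₗ[ℝ] C10 Ω) : Prop where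
  injective : Function.Injective ι
  bound : ∃ C : NNReal, 0 < C ∧ ∀ h : H, c1Norm Ω (ι h : Euc d → Euc d) ≤ C * ‖h‖ₑ

/-- The space `L²([0,1], H)` of square-integrable time-dependent vector fields. -/
abbrev L2Field (H : Type*) [NormedAddCommGroup H] : Type _ :=
  Lp H 2 (volume.restrict (Icc (0 : ℝ) 1))

/-- `φ` is a flow on `Ω` over `[0,1]` of the time-dependent vector field `u`, that is, a solution of
`∂ₜ φₜ = uₜ ∘ φₜ`, `φ₀(x) = x`. As `u` is only square-integrable in time, solutions are meant in the
sense of Carathéodory: `φₜ(x) = x + ∫₀ᵗ uₛ(φₛ(x)) ds`. -/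
def IsFlow {d : ℕ} (Ω : Set (Euc d)) {H : Type*} [NormedAddCommGroup H]
    [InnerProductSpace ℝ H] (ι : H →ₗ[ℝ] C10 Ω) (u : L2Field H) (φ : ℝ → Euc d → Euc d) : Prop :=
  ∀ x ∈ Ω,
    ContinuousOn (fun t => φ t x) (Icc 0 1) ∧
    IntervalIntegrable (fun s => (ι (u s) : Euc d → Euc d) (φ s x)) volume 0 1 ∧
    ∀ t ∈ Icc (0 : ℝ) 1,
      φ t x ∈ Ω ∧ φ t x = x + ∫ s in (0 : ℝ)..t, (ι (u s) : Euc d → Euc d) (φ s x)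

open Classical in
/-- The flow of `u` (the identity in case there were none). -/
noncomputable def flow {d : ℕ} (Ω : Set (Euc d)) {H : Type*} [NormedAddCommGroup H]
    [InnerProductSpace ℝ H] (ι : H →ₗ[ℝ] C10 Ω) (u : L2Field H) : ℝ → Euc d → Euc d :=
  if h : ∃ φ, IsFlow Ω ι u φ then h.choose else fun _ x => x

/-- The inverse `φ₁⁻¹` on `Ω` of the time-one map of the flow of `u`. -/
noncomputable def flowInv {d : ℕ} (Ω : Set (Euc d)) {H : Type*} [NormedAddCommGroup H]
    [InnerProductSpace ℝ H] (ι : H →ₗ[ℝ] C10 Ω) (u : L2Field H) : Euc d → Euc d :=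
  Function.invFunOn (flow Ω ι u 1) Ω

/-- The registration energy
`E(u) = 1/2 ∫₀¹ |uₜ|²_H dt + 1/(2σ²) ‖I₀ ∘ φ₁⁻¹ - I₁‖²_{L²(Ω)}`. -/
noncomputable def energy {d : ℕ} (Ω : Set (Euc d)) {H : Type*} [NormedAddCommGroup H]
    [InnerProductSpace ℝ H] (ι : H →ₗ[ℝ] C10 Ω) (σ : ℝ) (I₀ I₁ : Euc d → ℝ) (u : L2Field H) : ℝ :=
  1 / 2 * (∫ t in (0 : ℝ)..1, ‖u t‖ ^ 2) +
    1 / (2 * σ ^ 2) *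
      (eLpNorm (fun x => I₀ (flowInv Ω ι u x) - I₁ x) 2 (volume.restrict Ω)).toReal ^ 2

end LDDMM

namespace LDDMM

/-! ### Grönwall's inequality with an integrable coefficient. -/

section Gronwall

/-! The proof is the direct method. Extended by zero, each field of `H` is bounded and Lipschitz on
all of `ℝ^d` with constant `C‖h‖` (`norm_sub_le_of_fderiv_bound`), so `u ∈ L²([0,1], H)` has a
Lipschitz constant integrable in time. Picard iteration gives a flow on `ℝ^d`; points off `Ω` are
stationary, so by uniqueness the flow preserves `Ω`. By Grönwall the time-one map and its inverse
are Lipschitz with constant `exp (C‖u‖)`, uniform on bounded sets of fields.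

A minimizing sequence is bounded, hence has a weakly convergent subsequence. The displacement along
a fixed curve is a continuous linear function of the field, so it converges, uniformly in time by
equicontinuity; Grönwall turns this into pointwise convergence of the flows and of the inverse
time-one maps (`tendsto_globalFlowInv`).

For the misfit, `I₀` is replaced by a bounded continuous function. The error stays small after
composition because the inverse maps distort volume by a uniformly bounded factor, and Fatou's lemma
handles the continuous part (`eventually_misfit_le`). With weak lower semicontinuity of the norm,
the weak limit is a minimizer. -/

lemma intervalIntegrable_of_mem {F : Type*} [NormedAddCommGroup F] {f : ℝ → F} {t₀ t₁ s t : ℝ}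
    (hf : IntervalIntegrable f volume t₀ t₁) (hs : s ∈ Icc t₀ t₁) (ht : t ∈ Icc t₀ t₁) :
    IntervalIntegrable f volume s t :=
  hf.mono_set (by
    rw [uIcc_of_le (hs.1.trans hs.2)]
    exact uIcc_subset_Icc hs ht)

lemma absolutelyContinuousOnInterval_pow {A : ℝ → ℝ} {t₀ t : ℝ}
    (hA : AbsolutelyContinuousOnInterval A t₀ t) (n : ℕ) :
    AbsolutelyContinuousOnInterval (fun s => A s ^ n) t₀ t := by
  induction n with
  | zero =>
    simpa using (LipschitzWith.const (1 : ℝ)).lipschitzOnWith.absolutelyContinuousOnInterval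
  | succ n ih => simpa only [pow_succ] using ih.fun_mul hA

/-- As `a` is merely integrable, the primitive is differentiable only almost everywhere; absolute
continuity of its powers justifies the fundamental theorem of calculus. -/
lemma integral_mul_primitive_pow {a : ℝ → ℝ} {t₀ t : ℝ} (ha : IntervalIntegrable a volume t₀ t)
    (n : ℕ) :
    ∫ s in t₀..t, a s * (∫ r in t₀..s, a r) ^ n = (∫ r in t₀..t, a r) ^ (n + 1) / (n + 1) := by
  have hac := absolutelyContinuousOnInterval_pow
    (ha.absolutelyContinuousOnInterval_intervalIntegral left_mem_uIcc) (n + 1)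
  have h := hac.integral_deriv_eq_sub
  simp only [intervalIntegral.integral_same, ne_eq, Nat.add_eq_zero_iff, one_ne_zero, and_false,
    not_false_eq_true, zero_pow, sub_zero] at h
  rw [← h, eq_div_iff (by positivity), ← intervalIntegral.integral_mul_const]
  refine intervalIntegral.integral_congr_ae ?_
  filter_upwards [ha.ae_hasDerivAt_integral] with s hs hst
  have := ((hs (uIoc_subset_uIcc hst) t₀ left_mem_uIcc).pow (n + 1)).deriv
  simp only [Nat.add_sub_cancel] at this
  rw [show (fun s => (∫ r in t₀..s, a r) ^ (n + 1)) = (fun s => ∫ r in t₀..s, a r) ^ (n + 1) from rfl,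
    this]
  push_cast
  ring

lemma continuousOn_primitive {F : Type*} [NormedAddCommGroup F] [NormedSpace ℝ F] {f : ℝ → F}
    {t₀ t₁ : ℝ} (h : t₀ ≤ t₁) (hf : IntervalIntegrable f volume t₀ t₁) :
    ContinuousOn (fun t => ∫ s in t₀..t, f s) (Icc t₀ t₁) := by
  have := intervalIntegral.continuousOn_primitive_interval'  hf left_mem_uIcc
  rwa [uIcc_of_le h] at this

/-- Grönwall's inequality in integral form, with an integrable coefficient. -/
lemma gronwall_integral {D a : ℝ → ℝ} {t₀ t₁ c : ℝ} (h01 : t₀ ≤ t₁)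
    (ha : IntervalIntegrable a volume t₀ t₁) (ha0 : ∀ s, 0 ≤ a s)
    (hD : ContinuousOn D (Icc t₀ t₁)) (hc : 0 ≤ c)
    (h : ∀ t ∈ Icc t₀ t₁, D t ≤ c + ∫ s in t₀..t, a s * D s) :
    D t₁ ≤ c * Real.exp (∫ s in t₀..t₁, a s) := by
  set A : ℝ → ℝ := fun t => ∫ s in t₀..t, a s with hA
  obtain ⟨M, hM⟩ : ∃ M, ∀ t ∈ Icc t₀ t₁, D t ≤ M := by
    obtain ⟨M, hM⟩ := isCompact_Icc.bddAbove_image hD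
    exact ⟨M, fun t ht => hM (mem_image_of_mem _ ht)⟩
  have hAc : ContinuousOn A (Icc t₀ t₁) := continuousOn_primitive h01 ha
  have hmul : ∀ {f : ℝ → ℝ}, ContinuousOn f (Icc t₀ t₁) → ∀ t ∈ Icc t₀ t₁,
      IntervalIntegrable (fun s => a s * f s) volume t₀ t := by
    intro f hf t ht
    refine (intervalIntegrable_of_mem ha (left_mem_Icc.2 h01) ht).mul_continuousOn (hf.mono ?_)
    rw [uIcc_of_le ht.1]
    exact Icc_subset_Icc_right ht.2
  -- Feeding the hypothesis into itself `n` times, starting from the crude bound `M`, produces the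
  -- Taylor polynomial of the exponential and a remainder that tends to zero.
  have key : ∀ n : ℕ, ∀ t ∈ Icc t₀ t₁,
      D t ≤ c * (∑ k ∈ Finset.range n, A t ^ k / k.factorial) + M * (A t ^ n / n.factorial) := by
    intro n
    induction n with
    | zero => intro t ht; simpa using hM t ht
    | succ n ih =>
      intro t ht
      have hint : ∀ k : ℕ, IntervalIntegrable (fun s => a s * (A s ^ k / k.factorial)) volume t₀ t :=
        fun k => hmul ((hAc.pow k).div_const _) t ht
      have hval : ∀ k : ℕ, ∫ s in t₀..t, a s * (A s ^ k / k.factorial)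
          = A t ^ (k + 1) / (k + 1).factorial := by
        intro k
        simp_rw [← mul_div_assoc]
        rw [intervalIntegral.integral_div, integral_mul_primitive_pow
          (intervalIntegrable_of_mem ha (left_mem_Icc.2 h01) ht), Nat.factorial_succ, div_div]
        push_cast
        rfl
      have hsumint : IntervalIntegrable
          (fun s => ∑ k ∈ Finset.range n, a s * (A s ^ k / k.factorial)) volume t₀ t := by
        simpa only [Finset.sum_fn] using
          IntervalIntegrable.sum (Finset.range n) (fun k _ => hint k)
      refine (h t ht).trans ?_
      have hle : ∫ s in t₀..t, a s * D s ≤ ∫ s in t₀..t,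
          (c * (∑ k ∈ Finset.range n, a s * (A s ^ k / k.factorial))
            + M * (a s * (A s ^ n / n.factorial))) := by
        refine intervalIntegral.integral_mono_on ht.1 (hmul hD t ht) ?_ ?_
        · exact (hsumint.const_mul c).add ((hint n).const_mul M)
        · intro s hs
          have := mul_le_mul_of_nonneg_left (ih s ⟨hs.1, hs.2.trans ht.2⟩) (ha0 s)
          refine this.trans (le_of_eq ?_)
          rw [← Finset.mul_sum]
          ring
      have hsum : ∫ s in t₀..t,
          (c * (∑ k ∈ Finset.range n, a s * (A s ^ k / k.factorial))
            + M * (a s * (A s ^ n / n.factorial)))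
          = c * (∑ k ∈ Finset.range n, A t ^ (k + 1) / (k + 1).factorial)
            + M * (A t ^ (n + 1) / (n + 1).factorial) := by
        rw [intervalIntegral.integral_add, intervalIntegral.integral_const_mul,
          intervalIntegral.integral_const_mul, intervalIntegral.integral_finsetSum, hval]
        · simp_rw [hval]
        · exact fun k _ => hint k
        · exact hsumint.const_mul c
        · exact (hint n).const_mul M
      rw [hsum] at hle
      rw [Finset.sum_range_succ']
      simp only [pow_zero, Nat.factorial_zero, Nat.cast_one, div_one]
      linarith
  have hA0 : 0 ≤ A t₁ := intervalIntegral.integral_nonneg h01 fun s _ => ha0 s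
  have hlim : Tendsto (fun n : ℕ => c * Real.exp (A t₁) + M * (A t₁ ^ n / n.factorial)) atTop
      (𝓝 (c * Real.exp (A t₁) + M * 0)) :=
    ((FloorSemiring.tendsto_pow_div_factorial_atTop (A t₁)).const_mul M).const_add _
  rw [mul_zero, add_zero] at hlim
  refine ge_of_tendsto' hlim fun n => (key n t₁ (right_mem_Icc.2 h01)).trans ?_
  gcongr
  exact Real.sum_le_exp_of_nonneg hA0 n

/-- Grönwall's inequality on `[0,1]`, both forwards and backwards from the time `s`. -/
lemma gronwall_integral_abs {D a : ℝ → ℝ} {s c : ℝ} (hs : s ∈ Icc (0 : ℝ) 1)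
    (ha : IntervalIntegrable a volume 0 1) (ha0 : ∀ s, 0 ≤ a s)
    (hD : ContinuousOn D (Icc 0 1)) (hc : 0 ≤ c)
    (h : ∀ t ∈ Icc (0 : ℝ) 1, D t ≤ c + |∫ r in s..t, a r * D r|) (hD0 : ∀ t, 0 ≤ D t)
    {t : ℝ} (ht : t ∈ Icc (0 : ℝ) 1) :
    D t ≤ c * Real.exp (∫ r in (0 : ℝ)..1, a r) := by
  have hmono : ∀ {p q : ℝ}, 0 ≤ p → p ≤ q → q ≤ 1 →
      c * Real.exp (∫ r in p..q, a r) ≤ c * Real.exp (∫ r in (0 : ℝ)..1, a r) := by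
    intro p q hp hpq hq
    gcongr
    exact intervalIntegral.integral_mono_interval hp hpq hq (ae_of_all _ ha0) ha
  rcases le_total s t with hst | hts
  · refine (gronwall_integral hst (intervalIntegrable_of_mem ha hs ht) ha0
      (hD.mono (Icc_subset_Icc hs.1 ht.2)) hc fun q hq => ?_).trans (hmono hs.1 hst ht.2)
    refine (h q ⟨hs.1.trans hq.1, hq.2.trans ht.2⟩).trans (le_of_eq ?_)
    rw [abs_of_nonneg]
    exact intervalIntegral.integral_nonneg hq.1 fun r _ => mul_nonneg (ha0 r) (hD0 r)
  -- The backward case is the forward one after the reflection `r ↦ -r`.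
  · have := gronwall_integral (D := fun r => D (-r)) (a := fun r => a (-r)) (c := c)
      (neg_le_neg hts) ((IntervalIntegrable.iff_comp_neg (by finiteness)).1 (intervalIntegrable_of_mem ha hs ht))
      (fun r => ha0 _) (hD.comp continuousOn_neg fun r hr => ?_) hc fun q hq => ?_
    · simp only [neg_neg, intervalIntegral.integral_comp_neg (fun r => a r)] at this
      exact this.trans (hmono ht.1 hts hs.2)
    · exact ⟨by linarith [hr.2, ht.1], by linarith [hr.1, hs.2]⟩
    · refine (h (-q) ⟨by linarith [hq.2, ht.1], by linarith [hq.1, hs.2]⟩).trans (le_of_eq ?_)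
      rw [intervalIntegral.integral_comp_neg (fun r => a r * D r), neg_neg,
        intervalIntegral.integral_symm, abs_neg, abs_of_nonneg]
      exact intervalIntegral.integral_nonneg (by linarith [hq.1])
        fun r _ => mul_nonneg (ha0 r) (hD0 r)

end Gronwall

end LDDMM

/-! ### Carathéodory differential equations on `[0,1]`. -/

namespace LDDMM

section Caratheodory

variable {E : Type*} [NormedAddCommGroup E]

/-- A time-dependent vector field on `E` that is bounded and Lipschitz in space at every time `s`,
with a constant `a s` that is integrable in time. -/
structure IsCaratheodory (F : ℝ → E → E) (a : ℝ → ℝ) : Prop where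
  intervalIntegrable_bound : IntervalIntegrable a volume 0 1
  aestronglyMeasurable : ∀ γ : ℝ → E, ContinuousOn γ (Icc 0 1) →
    AEStronglyMeasurable (fun s => F s (γ s)) (volume.restrict (Icc 0 1))
  norm_le : ∀ s x, ‖F s x‖ ≤ a s
  norm_sub_le : ∀ s x y, ‖F s x - F s y‖ ≤ a s * ‖x - y‖

variable {F : ℝ → E → E} {a : ℝ → ℝ}

namespace IsCaratheodory

lemma bound_nonneg (hF : IsCaratheodory F a) (s : ℝ) : 0 ≤ a s :=
  (norm_nonneg _).trans (hF.norm_le s 0)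

lemma intervalIntegrable (hF : IsCaratheodory F a) {γ : ℝ → E} (hγ : ContinuousOn γ (Icc 0 1))
    {s t : ℝ} (hs : s ∈ Icc (0 : ℝ) 1) (ht : t ∈ Icc (0 : ℝ) 1) :
    IntervalIntegrable (fun r => F r (γ r)) volume s t := by
  refine intervalIntegrable_of_mem (hF.intervalIntegrable_bound.mono_fun ?_ ?_) hs ht
  · rw [uIoc_of_le zero_le_one]
    exact (hF.aestronglyMeasurable γ hγ).mono_measure
      (Measure.restrict_mono Ioc_subset_Icc_self le_rfl)
  · exact ae_of_all _ fun r => (hF.norm_le r _).trans (le_abs_self _)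

lemma intervalIntegrable_bound_mul (hF : IsCaratheodory F a) {D : ℝ → ℝ}
    (hD : ContinuousOn D (Icc 0 1)) {s t : ℝ} (hs : s ∈ Icc (0 : ℝ) 1) (ht : t ∈ Icc (0 : ℝ) 1) :
    IntervalIntegrable (fun r => a r * D r) volume s t :=
  intervalIntegrable_of_mem (hF.intervalIntegrable_bound.mul_continuousOn
    (by rwa [uIcc_of_le zero_le_one])) hs ht

lemma continuousOn_comp_one_sub {γ : ℝ → E} (hγ : ContinuousOn γ (Icc 0 1)) :
    ContinuousOn (fun t => γ (1 - t)) (Icc 0 1) :=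
  hγ.comp (by fun_prop) fun t ht => ⟨by linarith [ht.2], by linarith [ht.1]⟩

/-- Time reversal converts existence with prescribed initial value into existence with prescribed
final value, which yields the inverse flow. -/
lemma reverse (hF : IsCaratheodory F a) :
    IsCaratheodory (fun s x => -F (1 - s) x) (fun s => a (1 - s)) where
  intervalIntegrable_bound := by
    simpa using (hF.intervalIntegrable_bound.comp_sub_left 1).symm
  aestronglyMeasurable γ hγ := by
    have h := hF.aestronglyMeasurable _ (continuousOn_comp_one_sub hγ)
    have hmp : MeasurePreserving (fun t : ℝ => 1 - t) (volume.restrict (Icc 0 1))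
        (volume.restrict (Icc 0 1)) := by
      have := (Measure.measurePreserving_sub_left (volume : Measure ℝ) 1).restrict_preimage
        (measurableSet_Icc (a := (0 : ℝ)) (b := 1))
      simpa using this
    have h' := (h.comp_measurePreserving hmp).neg
    simp only [Function.comp_def, sub_sub_cancel] at h'
    exact h'
  norm_le s x := by simpa using hF.norm_le (1 - s) x
  norm_sub_le s x y := by
    rw [← neg_sub_neg, neg_neg, neg_neg, norm_sub_rev x y]
    exact hF.norm_sub_le (1 - s) y x

end IsCaratheodory

variable [NormedSpace ℝ E]

/-- `γ` solves `γ' = F(t, γ)` on `[0,1]` in the integrated sense. -/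
def IsSolution (F : ℝ → E → E) (γ : ℝ → E) : Prop :=
  ContinuousOn γ (Icc 0 1) ∧
    ∀ s ∈ Icc (0 : ℝ) 1, ∀ t ∈ Icc (0 : ℝ) 1, γ t = γ s + ∫ r in s..t, F r (γ r)

namespace IsCaratheodory

lemma norm_integral_sub_le (hF : IsCaratheodory F a) {γ η : ℝ → E}
    (hγ : ContinuousOn γ (Icc 0 1)) (hη : ContinuousOn η (Icc 0 1))
    {s t : ℝ} (hs : s ∈ Icc (0 : ℝ) 1) (ht : t ∈ Icc (0 : ℝ) 1) :
    ‖(∫ r in s..t, F r (γ r)) - ∫ r in s..t, F r (η r)‖ ≤ |∫ r in s..t, a r * ‖γ r - η r‖| := by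
  rw [← intervalIntegral.integral_sub (hF.intervalIntegrable hγ hs ht)
    (hF.intervalIntegrable hη hs ht)]
  exact intervalIntegral.norm_integral_le_abs_of_norm_le
    (ae_of_all _ fun r => hF.norm_sub_le r _ _)
    (hF.intervalIntegrable_bound_mul (hγ.sub hη).norm hs ht)

/-- A solution stays close to any curve that solves the equation up to a small error. -/
lemma norm_sub_le_of_approx (hF : IsCaratheodory F a) {γ η : ℝ → E} (hγ : IsSolution F γ)
    (hη : ContinuousOn η (Icc 0 1)) {s c : ℝ} (hs : s ∈ Icc (0 : ℝ) 1)
    (h : ∀ t ∈ Icc (0 : ℝ) 1, ‖(γ s + ∫ r in s..t, F r (η r)) - η t‖ ≤ c)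
    {t : ℝ} (ht : t ∈ Icc (0 : ℝ) 1) :
    ‖γ t - η t‖ ≤ c * Real.exp (∫ r in (0 : ℝ)..1, a r) := by
  refine gronwall_integral_abs (D := fun t => ‖γ t - η t‖) hs hF.intervalIntegrable_bound
    hF.bound_nonneg (hγ.1.sub hη).norm ((norm_nonneg _).trans (h s hs)) (fun q hq => ?_)
    (fun _ => norm_nonneg _) ht
  calc ‖γ q - η q‖ = ‖((γ s + ∫ r in s..q, F r (η r)) - η q)
        + ((∫ r in s..q, F r (γ r)) - ∫ r in s..q, F r (η r))‖ := by
        rw [hγ.2 s hs q hq]; congr 1; abel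
    _ ≤ _ := (norm_add_le _ _).trans
        (add_le_add (h q hq) (hF.norm_integral_sub_le hγ.1 hη hs hq))

/-- The times `s` and `t` come in either order, so this one estimate gives uniqueness and the
Lipschitz bounds for both the time-one map and its inverse. -/
lemma norm_sub_le_exp_mul (hF : IsCaratheodory F a) {γ η : ℝ → E} (hγ : IsSolution F γ)
    (hη : IsSolution F η) {s t : ℝ} (hs : s ∈ Icc (0 : ℝ) 1) (ht : t ∈ Icc (0 : ℝ) 1) :
    ‖γ t - η t‖ ≤ Real.exp (∫ r in (0 : ℝ)..1, a r) * ‖γ s - η s‖ := by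
  rw [mul_comm]
  refine hF.norm_sub_le_of_approx hγ hη.1 hs (fun q hq => le_of_eq ?_) ht
  rw [hη.2 s hs q hq]
  congr 1
  abel

lemma isSolution_of_forall_eq (hF : IsCaratheodory F a) {γ : ℝ → E} {x : E}
    (hγ : ContinuousOn γ (Icc 0 1)) (h : ∀ t ∈ Icc (0 : ℝ) 1, γ t = x + ∫ r in (0 : ℝ)..t, F r (γ r)) :
    IsSolution F γ := by
  refine ⟨hγ, fun s hs t ht => ?_⟩
  have h0 : (0 : ℝ) ∈ Icc (0 : ℝ) 1 := left_mem_Icc.2 zero_le_one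
  rw [h t ht, h s hs, add_assoc, intervalIntegral.integral_add_adjacent_intervals
    (hF.intervalIntegrable hγ h0 hs) (hF.intervalIntegrable hγ hs ht)]

/-- The Picard operator. -/
noncomputable def picard (hF : IsCaratheodory F a) (x : E) (γ : C(Icc (0 : ℝ) 1, E)) :
    C(Icc (0 : ℝ) 1, E) where
  toFun t := x + ∫ s in (0 : ℝ)..t, F s (IccExtend zero_le_one γ s)
  continuous_toFun := by
    have h := continuousOn_primitive zero_le_one (hF.intervalIntegrable
      (γ.continuous.Icc_extend' (h := zero_le_one)).continuousOn (left_mem_Icc.2 zero_le_one)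
      (right_mem_Icc.2 zero_le_one))
    exact continuous_const.add (continuousOn_iff_continuous_domRestrict.1 h)

/-- The factorial makes some iterate a contraction on the whole of `[0,1]`, with no smallness of `a`
and no gluing of short intervals. -/
lemma norm_picard_iterate_sub_le (hF : IsCaratheodory F a) (x : E) (γ η : C(Icc (0 : ℝ) 1, E))
    (n : ℕ) (t : Icc (0 : ℝ) 1) :
    ‖((hF.picard x)^[n] γ) t - ((hF.picard x)^[n] η) t‖
      ≤ (∫ r in (0 : ℝ)..t, a r) ^ n / n.factorial * dist γ η := by
  induction n generalizing t with
  | zero => simpa [dist_eq_norm] using ContinuousMap.dist_apply_le_dist (f := γ) (g := η) t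
  | succ n ih =>
    rw [Function.iterate_succ_apply', Function.iterate_succ_apply']
    set γ' := (hF.picard x)^[n] γ
    set η' := (hF.picard x)^[n] η
    have h0 : (0 : ℝ) ∈ Icc (0 : ℝ) 1 := left_mem_Icc.2 zero_le_one
    have hγ' : ContinuousOn (IccExtend zero_le_one γ') (Icc (0 : ℝ) 1) :=
      γ'.continuous.Icc_extend'.continuousOn
    have hη' : ContinuousOn (IccExtend zero_le_one η') (Icc (0 : ℝ) 1) :=
      η'.continuous.Icc_extend'.continuousOn
    have h1 : ‖(hF.picard x γ') t - (hF.picard x η') t‖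
        ≤ |∫ r in (0 : ℝ)..t, a r * ‖IccExtend zero_le_one γ' r - IccExtend zero_le_one η' r‖| := by
      simpa [picard] using hF.norm_integral_sub_le hγ' hη' h0 t.2
    refine h1.trans ?_
    have hA : ContinuousOn (fun s => ∫ r in (0 : ℝ)..s, a r) (Icc 0 1) :=
      continuousOn_primitive zero_le_one hF.intervalIntegrable_bound
    rw [abs_of_nonneg (intervalIntegral.integral_nonneg t.2.1
      fun r _ => mul_nonneg (hF.bound_nonneg r) (norm_nonneg _))]
    calc ∫ r in (0 : ℝ)..t, a r * ‖IccExtend zero_le_one γ' r - IccExtend zero_le_one η' r‖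
        ≤ ∫ r in (0 : ℝ)..t, a r * (∫ q in (0 : ℝ)..r, a q) ^ n * (dist γ η / n.factorial) := by
          refine intervalIntegral.integral_mono_on t.2.1
            (hF.intervalIntegrable_bound_mul (hγ'.sub hη').norm h0 t.2)
            ((hF.intervalIntegrable_bound_mul (hA.pow n) h0 t.2).mul_const _) fun r hr => ?_
          have hr' : r ∈ Icc (0 : ℝ) 1 := ⟨hr.1, hr.2.trans t.2.2⟩
          rw [IccExtend_of_mem _ _ hr', IccExtend_of_mem _ _ hr', mul_assoc]
          refine mul_le_mul_of_nonneg_left ((ih ⟨r, hr'⟩).trans (le_of_eq ?_)) (hF.bound_nonneg r)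
          ring
      _ = _ := by
          rw [intervalIntegral.integral_mul_const, integral_mul_primitive_pow
            (intervalIntegrable_of_mem hF.intervalIntegrable_bound h0 t.2), Nat.factorial_succ]
          push_cast
          field_simp

lemma exists_isSolution_zero [CompleteSpace E] (hF : IsCaratheodory F a) (x : E) :
    ∃ γ, IsSolution F γ ∧ γ 0 = x := by
  set K := ∫ r in (0 : ℝ)..1, a r
  have hK : 0 ≤ K := intervalIntegral.integral_nonneg zero_le_one fun r _ => hF.bound_nonneg r
  obtain ⟨n, hn⟩ : ∃ n : ℕ, K ^ n / n.factorial < 1 :=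
    ((FloorSemiring.tendsto_pow_div_factorial_atTop K).eventually_lt_const one_pos).exists
  have hcontr : ContractingWith (K ^ n / n.factorial).toNNReal
      (hF.picard x)^[n] := by
    refine ⟨Real.toNNReal_lt_one.2 hn, LipschitzWith.of_dist_le_mul fun γ η => ?_⟩
    rw [Real.coe_toNNReal _ (by positivity), ContinuousMap.dist_le (by positivity)]
    intro t
    rw [dist_eq_norm]
    refine (hF.norm_picard_iterate_sub_le x γ η n t).trans ?_
    have h0 : 0 ≤ ∫ r in (0 : ℝ)..t, a r :=
      intervalIntegral.integral_nonneg t.2.1 fun r _ => hF.bound_nonneg r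
    have h1 : ∫ r in (0 : ℝ)..t, a r ≤ K := intervalIntegral.integral_mono_interval le_rfl t.2.1
      t.2.2 (ae_of_all _ hF.bound_nonneg) hF.intervalIntegrable_bound
    gcongr
  set γ := hcontr.fixedPoint with hγ
  have hfix : hF.picard x γ = γ := hcontr.isFixedPt_fixedPoint_iterate
  have heq : ∀ t ∈ Icc (0 : ℝ) 1, IccExtend zero_le_one γ t
      = x + ∫ s in (0 : ℝ)..t, F s (IccExtend zero_le_one γ s) := fun t ht => by
    rw [IccExtend_of_mem _ _ ht, ← DFunLike.congr_fun hfix ⟨t, ht⟩]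
    rfl
  refine ⟨IccExtend zero_le_one γ, hF.isSolution_of_forall_eq
    γ.continuous.Icc_extend'.continuousOn heq, ?_⟩
  rw [heq 0 (left_mem_Icc.2 zero_le_one)]
  simp

lemma exists_isSolution_one [CompleteSpace E] (hF : IsCaratheodory F a) (x : E) :
    ∃ γ, IsSolution F γ ∧ γ 1 = x := by
  obtain ⟨γ, hγ, h0⟩ := hF.reverse.exists_isSolution_zero x
  refine ⟨fun t => γ (1 - t), ⟨continuousOn_comp_one_sub hγ.1, fun s hs t ht => ?_⟩, by simpa⟩
  have := hγ.2 (1 - s) ⟨by linarith [hs.2], by linarith [hs.1]⟩ (1 - t)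
    ⟨by linarith [ht.2], by linarith [ht.1]⟩
  change γ (1 - t) = γ (1 - s) + ∫ r in s..t, F r (γ (1 - r))
  rw [this, intervalIntegral.integral_neg, ← intervalIntegral.integral_symm,
    ← intervalIntegral.integral_comp_sub_left (fun r => F (1 - r) (γ r)) 1]
  simp

end IsCaratheodory

end Caratheodory

end LDDMM

/-! ### Lipschitz bounds for admissible fields, and `L²` estimates in time. -/

namespace LDDMM

variable {d : ℕ} {Ω : Set (Euc d)}

section LipschitzExtension

lemma norm_fderiv_le_sum_norm_gradient {v : Euc d → Euc d} {x : Euc d}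
    (hv : DifferentiableAt ℝ v x) :
    ‖fderiv ℝ v x‖ ≤ ∑ i : Fin d, ‖gradient (𝕜 := ℝ) (fun y => v y i) x‖ := by
  refine ContinuousLinearMap.opNorm_le_bound _ (Finset.sum_nonneg fun _ _ => norm_nonneg _)
    fun w => ?_
  rw [Finset.sum_mul]
  have hw : ∀ i, |fderiv ℝ v x w i| ≤ ‖gradient (𝕜 := ℝ) (fun y => v y i) x‖ * ‖w‖ := by
    intro i
    have h1 : fderiv ℝ (fun y => v y i) x
        = (EuclideanSpace.proj i : Euc d →L[ℝ] ℝ).comp (fderiv ℝ v x) :=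
      ((EuclideanSpace.proj i : Euc d →L[ℝ] ℝ).hasFDerivAt.comp x hv.hasFDerivAt).fderiv
    have h2 := (fderiv ℝ (fun y => v y i) x).le_opNorm w
    rw [gradient, LinearIsometryEquiv.norm_map]
    rw [h1] at h2 ⊢
    exact h2
  calc ‖fderiv ℝ v x w‖ ≤ ∑ i, |fderiv ℝ v x w i| := by
        rw [EuclideanSpace.norm_eq]
        refine Real.sqrt_le_iff.2 ⟨Finset.sum_nonneg fun _ _ => abs_nonneg _, ?_⟩
        exact Finset.sum_sq_le_sq_sum_of_nonneg fun _ _ => abs_nonneg _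
    _ ≤ _ := Finset.sum_le_sum fun i _ => hw i

/-- A `C¹` vector field on `Ω` whose extension by zero is continuous is globally Lipschitz as soon
as its derivative on `Ω` is bounded. -/
lemma norm_sub_le_of_fderiv_bound {F G : Type*} [NormedAddCommGroup F] [NormedSpace ℝ F]
    [ProperSpace F] [NormedAddCommGroup G] [NormedSpace ℝ G] {Ω : Set F} (hΩ : IsOpen Ω)
    {v : F → G} {L : ℝ} (hL : 0 ≤ L) (hd : ∀ x ∈ Ω, DifferentiableAt ℝ v x)
    (hb : ∀ x ∈ Ω, ‖fderiv ℝ v x‖ ≤ L) (h0 : ∀ x ∉ Ω, v x = 0) (hc : Continuous v) (x y : F) :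
    ‖v x - v y‖ ≤ L * ‖x - y‖ := by
  have hin : ∀ s ⊆ Ω, Convex ℝ s → ∀ x ∈ s, ∀ y ∈ s, ‖v x - v y‖ ≤ L * ‖x - y‖ :=
    fun s hs hconv x hx y hy => hconv.norm_image_sub_le_of_norm_hasFDerivWithin_le
      (fun z hz => (hd z (hs hz)).hasFDerivAt.hasFDerivWithinAt) (fun z hz => hb z (hs hz)) hy hx
  -- With `w` a point of the complement nearest to `x`, the open ball about `x` through `w` lies in
  -- `Ω`. The Lipschitz bound there extends to the closed ball, where `v w = 0`.
  have hout : ∀ x z, z ∉ Ω → ‖v x‖ ≤ L * ‖x - z‖ := by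
    intro x z hz
    by_cases hx : x ∈ Ω
    swap
    · rw [h0 x hx, norm_zero]; positivity
    have hne : Ωᶜ.Nonempty := ⟨z, hz⟩
    obtain ⟨w, hw, hwd⟩ := hΩ.isClosed_compl.exists_infDist_eq_dist hne x
    have hwz : ‖x - w‖ ≤ ‖x - z‖ := by
      rw [← dist_eq_norm, ← dist_eq_norm, ← hwd]
      exact Metric.infDist_le_dist_of_mem hz
    have hr : dist x w ≠ 0 := by
      rw [dist_ne_zero]
      rintro rfl
      exact hw hx
    have hball : Metric.ball x (dist x w) ⊆ Ω := by
      rw [← hwd]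
      intro q hq
      by_contra hqΩ
      exact absurd (Metric.infDist_le_dist_of_mem (x := x) (s := Ωᶜ) hqΩ)
        (not_le.2 (by rwa [Metric.mem_ball, dist_comm] at hq))
    have hlip : LipschitzOnWith L.toNNReal v (Metric.ball x (dist x w)) :=
      LipschitzOnWith.of_dist_le_mul fun p hp q hq => by
        rw [dist_eq_norm, dist_eq_norm, Real.coe_toNNReal _ hL]
        exact hin _ hball (convex_ball _ _) p hp q hq
    have hcl := hlip.closure hc.continuousOn
    rw [closure_ball x hr] at hcl
    have := hcl.dist_le_mul x (Metric.mem_closedBall_self dist_nonneg) w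
      (by rw [Metric.mem_closedBall, dist_comm])
    rw [h0 w hw, dist_zero_right, dist_eq_norm, Real.coe_toNNReal _ hL] at this
    exact this.trans (mul_le_mul_of_nonneg_left hwz hL)
  -- If the segment leaves `Ω` at `z`, both values are compared with zero, and the distances to `z`
  -- add up to `‖x - y‖`.
  by_cases hseg : segment ℝ x y ⊆ Ω
  · exact hin _ hseg (convex_segment x y) x (left_mem_segment ℝ x y) y (right_mem_segment ℝ x y)
  · obtain ⟨z, hz, hzΩ⟩ := not_subset.1 hseg
    have hxyz := dist_add_dist_of_mem_segment hz
    rw [dist_eq_norm, dist_eq_norm, dist_eq_norm, norm_sub_rev z y] at hxyz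
    calc ‖v x - v y‖ ≤ ‖v x‖ + ‖v y‖ := norm_sub_le _ _
      _ ≤ L * ‖x - z‖ + L * ‖y - z‖ := add_le_add (hout x z hzΩ) (hout y z hzΩ)
      _ = L * ‖x - y‖ := by rw [← mul_add, hxyz]

end LipschitzExtension

section L2

variable {H : Type*} [NormedAddCommGroup H]

lemma intervalIntegrable_of_memLp_two {F : Type*} [NormedAddCommGroup F] {f : ℝ → F}
    (hf : MemLp f 2 (volume.restrict (Icc (0 : ℝ) 1))) {s t : ℝ} (hs : s ∈ Icc (0 : ℝ) 1)
    (ht : t ∈ Icc (0 : ℝ) 1) : IntervalIntegrable f volume s t := by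
  have h : IntegrableOn f (Icc (0 : ℝ) 1) volume := hf.integrable one_le_two
  exact intervalIntegrable_of_mem
    ((intervalIntegrable_iff_integrableOn_Icc_of_le zero_le_one).2 h) hs ht

/-- Cauchy–Schwarz against the constant `1`. The modulus `√|t - s|` later supplies equicontinuity of
displacements. -/
lemma integral_norm_le_sqrt_mul (u : L2Field H) {s t : ℝ} (hs : s ∈ Icc (0 : ℝ) 1)
    (ht : t ∈ Icc (0 : ℝ) 1) : |∫ r in s..t, ‖u r‖| ≤ √|t - s| * ‖u‖ := by
  wlog hst : s ≤ t generalizing s t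
  · rw [intervalIntegral.integral_symm, abs_neg, abs_sub_comm]
    exact this ht hs (le_of_not_ge hst)
  rw [abs_of_nonneg (intervalIntegral.integral_nonneg hst fun _ _ => norm_nonneg _),
    abs_of_nonneg (sub_nonneg.2 hst), intervalIntegral.integral_of_le hst]
  have hsub : Ioc s t ⊆ Icc 0 1 := fun r hr => ⟨hs.1.trans hr.1.le, hr.2.trans ht.2⟩
  have hle : volume.restrict (Ioc s t) ≤ volume.restrict (Icc (0 : ℝ) 1) :=
    Measure.restrict_mono hsub le_rfl
  have hmeas : AEStronglyMeasurable u (volume.restrict (Ioc s t)) :=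
    (Lp.aestronglyMeasurable u).mono_measure hle
  have h1 := eLpNorm_le_eLpNorm_mul_rpow_measure_univ (p := 1) (q := 2) one_le_two hmeas
  have h2 : eLpNorm u 2 (volume.restrict (Ioc s t)) ≤ eLpNorm u 2 (volume.restrict (Icc 0 1)) :=
    eLpNorm_mono_measure _ hle
  rw [integral_norm_eq_lintegral_enorm hmeas, ← eLpNorm_one_eq_lintegral_enorm, Lp.norm_def]
  have h3 := h1.trans (mul_le_mul_left h2 _)
  have h4 := ENNReal.toReal_mono (by
    refine ENNReal.mul_ne_top (Lp.eLpNorm_ne_top u) (ENNReal.rpow_ne_top_of_nonneg ?_ (by simp))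
    norm_num) h3
  refine h4.trans (le_of_eq ?_)
  rw [ENNReal.toReal_mul, mul_comm, ← ENNReal.toReal_rpow]
  congr 1
  rw [Measure.restrict_apply_univ, Real.volume_Ioc, ENNReal.toReal_ofReal (sub_nonneg.2 hst),
    Real.sqrt_eq_rpow]
  norm_num

lemma integral_norm_le_norm (u : L2Field H) {s t : ℝ} (hs : s ∈ Icc (0 : ℝ) 1)
    (ht : t ∈ Icc (0 : ℝ) 1) : |∫ r in s..t, ‖u r‖| ≤ ‖u‖ := by
  refine (integral_norm_le_sqrt_mul u hs ht).trans ?_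
  have : √|t - s| ≤ 1 := Real.sqrt_le_one.2 (by rw [abs_le]; constructor <;> linarith [hs.1, hs.2, ht.1, ht.2])
  exact mul_le_of_le_one_left (norm_nonneg _) this

end L2

variable {H : Type*} [NormedAddCommGroup H] [InnerProductSpace ℝ H]

/-- The vector fields `ι h`, extended by zero, are bounded and Lipschitz with constant `C |h|`. -/
structure HasLipschitzBound (ι : H →ₗ[ℝ] C10 Ω) (C : ℝ) : Prop where
  nonneg : 0 ≤ C
  norm_le : ∀ h x, ‖(ι h : Euc d → Euc d) x‖ ≤ C * ‖h‖
  norm_sub_le : ∀ h x y,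
    ‖(ι h : Euc d → Euc d) x - (ι h : Euc d → Euc d) y‖ ≤ C * ‖h‖ * ‖x - y‖

lemma IsAdmissible.exists_hasLipschitzBound {ι : H →ₗ[ℝ] C10 Ω} (hι : IsAdmissible Ω ι)
    (hΩ : IsOpen Ω) : ∃ C, HasLipschitzBound ι C := by
  obtain ⟨C, -, hC⟩ := hι.bound
  have key : ∀ h, ∀ x ∈ Ω, ‖(ι h : Euc d → Euc d) x‖
      + ∑ i : Fin d, ‖gradient (𝕜 := ℝ) (fun y => (ι h : Euc d → Euc d) y i) x‖ ≤ C * ‖h‖ := by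
    intro h x hx
    have h1 := (le_iSup₂ (f := fun x (_ : x ∈ Ω) => ‖(ι h : Euc d → Euc d) x‖ₑ
      + ∑ i : Fin d, ‖gradient (𝕜 := ℝ) (fun y => (ι h : Euc d → Euc d) y i) x‖ₑ) x hx).trans (hC h)
    have h2 := ENNReal.toReal_mono (by finiteness) h1
    rw [ENNReal.toReal_add (by finiteness) (ENNReal.sum_ne_top.2 fun _ _ => by finiteness),
      ENNReal.toReal_sum (fun _ _ => by finiteness)] at h2
    simpa using h2
  refine ⟨C, C.2, fun h x => ?_, fun h x y => ?_⟩
  · by_cases hx : x ∈ Ω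
    · exact le_trans (le_add_of_nonneg_right (Finset.sum_nonneg fun _ _ => norm_nonneg _))
        (key h x hx)
    · rw [(ι h).2.2.1 x hx, norm_zero]
      positivity
  · have hd : ∀ x ∈ Ω, DifferentiableAt ℝ (ι h : Euc d → Euc d) x := fun x hx =>
      ((ι h).2.1.differentiableOn one_ne_zero).differentiableAt (hΩ.mem_nhds hx)
    refine norm_sub_le_of_fderiv_bound hΩ (by positivity) hd (fun x hx => ?_)
      (ι h).2.2.1 (ι h).2.2.2.1 x y
    exact (norm_fderiv_le_sum_norm_gradient (hd x hx)).trans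
      ((le_add_of_nonneg_left (norm_nonneg _)).trans (key h x hx))

end LDDMM

/-! ### Trajectories and their dependence on the field in the weak topology. -/

namespace LDDMM

variable {d : ℕ} {Ω : Set (Euc d)} {H : Type*} [NormedAddCommGroup H] [InnerProductSpace ℝ H]

/-- The time-dependent vector field on `ℝ^d` given by `u ∈ L²([0,1], H)`. -/
noncomputable def velocity (ι : H →ₗ[ℝ] C10 Ω) (u : L2Field H) (s : ℝ) (x : Euc d) : Euc d :=
  (ι (u s) : Euc d → Euc d) x

variable {ι : H →ₗ[ℝ] C10 Ω} {C : ℝ}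

namespace HasLipschitzBound

/-- Joint continuity is what makes the velocity along a continuous curve measurable in time. -/
lemma continuous_uncurry (hC : HasLipschitzBound ι C) :
    Continuous fun p : H × Euc d => (ι p.1 : Euc d → Euc d) p.2 := by
  rw [continuous_iff_continuousAt]
  rintro ⟨h, x⟩
  have hlim : Tendsto (fun p : H × Euc d => C * ‖p.1 - h‖ + C * ‖h‖ * ‖p.2 - x‖) (𝓝 (h, x))
      (𝓝 0) := by
    have : Continuous fun p : H × Euc d => C * ‖p.1 - h‖ + C * ‖h‖ * ‖p.2 - x‖ := by fun_prop
    simpa using this.tendsto (h, x)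
  rw [ContinuousAt, tendsto_iff_norm_sub_tendsto_zero]
  refine squeeze_zero (fun _ => norm_nonneg _) (fun p => ?_) hlim
  have h1 : (ι p.1 : Euc d → Euc d) p.2 - (ι h : Euc d → Euc d) x
      = (ι (p.1 - h) : Euc d → Euc d) p.2
        + ((ι h : Euc d → Euc d) p.2 - (ι h : Euc d → Euc d) x) := by
    rw [map_sub, Submodule.coe_sub, Pi.sub_apply]
    abel
  rw [h1]
  exact (norm_add_le _ _).trans (add_le_add (hC.norm_le _ _) (hC.norm_sub_le _ _ _))

lemma isCaratheodory (hC : HasLipschitzBound ι C) (u : L2Field H) :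
    IsCaratheodory (velocity ι u) (fun s => C * ‖u s‖) where
  intervalIntegrable_bound := (intervalIntegrable_of_memLp_two (Lp.memLp u)
    (left_mem_Icc.2 zero_le_one) (right_mem_Icc.2 zero_le_one)).norm.const_mul C
  aestronglyMeasurable _ hγ := hC.continuous_uncurry.comp_aestronglyMeasurable
    ((Lp.aestronglyMeasurable u).prodMk (hγ.aestronglyMeasurable measurableSet_Icc))
  norm_le _ x := hC.norm_le _ x
  norm_sub_le _ x y := hC.norm_sub_le _ x y

lemma integral_bound_le (hC : HasLipschitzBound ι C) (u : L2Field H) :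
    ∫ r in (0 : ℝ)..1, C * ‖u r‖ ≤ C * ‖u‖ := by
  rw [intervalIntegral.integral_const_mul]
  exact mul_le_mul_of_nonneg_left ((le_abs_self _).trans (integral_norm_le_norm u
    (left_mem_Icc.2 zero_le_one) (right_mem_Icc.2 zero_le_one))) hC.nonneg

lemma norm_sub_le_exp_mul (hC : HasLipschitzBound ι C) {u : L2Field H} {γ η : ℝ → Euc d}
    (hγ : IsSolution (velocity ι u) γ) (hη : IsSolution (velocity ι u) η) {s t : ℝ}
    (hs : s ∈ Icc (0 : ℝ) 1) (ht : t ∈ Icc (0 : ℝ) 1) :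
    ‖γ t - η t‖ ≤ Real.exp (C * ‖u‖) * ‖γ s - η s‖ := by
  refine ((hC.isCaratheodory u).norm_sub_le_exp_mul hγ hη hs ht).trans ?_
  gcongr
  exact hC.integral_bound_le u

lemma eq_of_eq (hC : HasLipschitzBound ι C) {u : L2Field H} {γ η : ℝ → Euc d}
    (hγ : IsSolution (velocity ι u) γ) (hη : IsSolution (velocity ι u) η) {s t : ℝ}
    (hs : s ∈ Icc (0 : ℝ) 1) (ht : t ∈ Icc (0 : ℝ) 1) (h : γ s = η s) : γ t = η t := by
  have := hC.norm_sub_le_exp_mul hγ hη hs ht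
  rw [h, sub_self, norm_zero, mul_zero] at this
  exact sub_eq_zero.1 (norm_le_zero_iff.1 this)

/-- Points outside `Ω` are stationary. -/
lemma isSolution_const {u : L2Field H} {z : Euc d} (hz : z ∉ Ω) :
    IsSolution (velocity ι u) fun _ => z := by
  refine ⟨continuousOn_const, fun s _ t _ => ?_⟩
  simp [velocity, (ι _).2.2.1 z hz]

/-- A trajectory that is at `z ∉ Ω` at some time agrees there with the constant solution `z`, hence
at all times. -/
lemma mem_of_mem (hC : HasLipschitzBound ι C) {u : L2Field H} {γ : ℝ → Euc d}
    (hγ : IsSolution (velocity ι u) γ) {s t : ℝ} (hs : s ∈ Icc (0 : ℝ) 1)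
    (ht : t ∈ Icc (0 : ℝ) 1) (h : γ s ∈ Ω) : γ t ∈ Ω := by
  by_contra hz
  exact hz (hC.eq_of_eq (isSolution_const hz) hγ ht hs rfl ▸ h)

lemma norm_integral_velocity_le (hC : HasLipschitzBound ι C) (u : L2Field H) (γ : ℝ → Euc d)
    {s t : ℝ} (hs : s ∈ Icc (0 : ℝ) 1) (ht : t ∈ Icc (0 : ℝ) 1) :
    ‖∫ r in s..t, velocity ι u r (γ r)‖ ≤ C * (√|t - s| * ‖u‖) := by
  have h1 : ‖∫ r in s..t, velocity ι u r (γ r)‖ ≤ |∫ r in s..t, C * ‖u r‖| :=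
    intervalIntegral.norm_integral_le_abs_of_norm_le
      (ae_of_all _ fun r => hC.norm_le (u r) (γ r))
      (intervalIntegrable_of_mem (hC.isCaratheodory u).intervalIntegrable_bound hs ht)
  rw [intervalIntegral.integral_const_mul, abs_mul, abs_of_nonneg hC.nonneg] at h1
  exact h1.trans (mul_le_mul_of_nonneg_left (integral_norm_le_sqrt_mul u hs ht) hC.nonneg)

/-- The displacement along a fixed curve `γ` up to time `t`, as a function of the field. -/
noncomputable def displacement (hC : HasLipschitzBound ι C) {γ : ℝ → Euc d}
    (hγ : ContinuousOn γ (Icc 0 1)) {t : ℝ} (ht : t ∈ Icc (0 : ℝ) 1) : L2Field H →L[ℝ] Euc d :=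
  LinearMap.mkContinuous
    { toFun := fun u => ∫ r in (0 : ℝ)..t, velocity ι u r (γ r)
      map_add' := fun u v => by
        have h0 := left_mem_Icc.2 (zero_le_one (α := ℝ))
        rw [← intervalIntegral.integral_add ((hC.isCaratheodory u).intervalIntegrable hγ h0 ht)
          ((hC.isCaratheodory v).intervalIntegrable hγ h0 ht)]
        refine intervalIntegral.integral_congr_ae ?_
        filter_upwards [(ae_restrict_iff' measurableSet_Icc).1 (Lp.coeFn_add u v)] with r hr hrt
        rw [uIoc_of_le ht.1] at hrt
        rw [velocity, hr ⟨hrt.1.le, hrt.2.trans ht.2⟩]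
        simp [velocity]
      map_smul' := fun c u => by
        rw [RingHom.id_apply, ← intervalIntegral.integral_smul]
        refine intervalIntegral.integral_congr_ae ?_
        filter_upwards [(ae_restrict_iff' measurableSet_Icc).1 (Lp.coeFn_smul c u)] with r hr hrt
        rw [uIoc_of_le ht.1] at hrt
        rw [velocity, hr ⟨hrt.1.le, hrt.2.trans ht.2⟩]
        simp [velocity] }
    (C * √|t - 0|) fun u => by
      rw [mul_assoc]
      exact hC.norm_integral_velocity_le u γ (left_mem_Icc.2 zero_le_one) ht

/-- Along a weakly convergent sequence of fields, displacements converge uniformly in time. -/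
lemma tendstoUniformlyOn_integral_velocity (hC : HasLipschitzBound ι C) {u : ℕ → L2Field H}
    {u' : L2Field H} {R : ℝ} (hR : ∀ n, ‖u n‖ ≤ R)
    (hu : ∀ L : StrongDual ℝ (L2Field H), Tendsto (fun n => L (u n)) atTop (𝓝 (L u')))
    {γ : ℝ → Euc d} (hγ : ContinuousOn γ (Icc 0 1)) :
    TendstoUniformlyOn (fun n t => ∫ r in (0 : ℝ)..t, velocity ι (u n) r (γ r))
      (fun t => ∫ r in (0 : ℝ)..t, velocity ι u' r (γ r)) atTop (Icc 0 1) := by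
  rw [← tendstoLocallyUniformlyOn_iff_tendstoUniformlyOn_of_compact isCompact_Icc,
    Metric.tendstoLocallyUniformlyOn_iff]
  intro ε hε t ht
  have hpt : Tendsto (fun n => ∫ r in (0 : ℝ)..t, velocity ι (u n) r (γ r)) atTop
      (𝓝 (∫ r in (0 : ℝ)..t, velocity ι u' r (γ r))) := by
    -- Each coordinate of the displacement is a continuous linear functional of the field.
    exact ((PiLp.continuous_toLp 2 _).tendsto _).comp (tendsto_pi_nhds.2 fun i =>
      hu ((EuclideanSpace.proj i : Euc d →L[ℝ] ℝ).comp (hC.displacement hγ ht)))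
  have hinc : ∀ (w : L2Field H) (s : ℝ), s ∈ Icc (0 : ℝ) 1 →
      dist (∫ r in (0 : ℝ)..s, velocity ι w r (γ r)) (∫ r in (0 : ℝ)..t, velocity ι w r (γ r))
        ≤ C * (√|s - t| * ‖w‖) := by
    intro w s hs
    have h0 := left_mem_Icc.2 (zero_le_one (α := ℝ))
    rw [dist_eq_norm, intervalIntegral.integral_interval_sub_left
      ((hC.isCaratheodory w).intervalIntegrable hγ h0 hs)
      ((hC.isCaratheodory w).intervalIntegrable hγ h0 ht)]
    exact hC.norm_integral_velocity_le w γ ht hs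
  have hmod : Tendsto (fun s : ℝ => C * (√|s - t| * ‖u'‖) + C * (√|s - t| * R)) (𝓝[Icc 0 1] t)
      (𝓝 0) := by
    have : Continuous fun s : ℝ => C * (√|s - t| * ‖u'‖) + C * (√|s - t| * R) := by fun_prop
    simpa using (this.tendsto t).mono_left nhdsWithin_le_nhds
  -- On this neighbourhood of `t` the increments for `u'` and for every `u n` together cost less
  -- than `ε / 2`; convergence at `t` pays the rest.
  refine ⟨{s | C * (√|s - t| * ‖u'‖) + C * (√|s - t| * R) < ε / 2} ∩ Icc 0 1,
    inter_mem (hmod.eventually_lt_const (half_pos hε)) self_mem_nhdsWithin, ?_⟩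
  filter_upwards [Metric.tendsto_nhds.1 hpt (ε / 2) (half_pos hε)] with n hn s hs
  have h1 := hinc u' s hs.2
  have h2 := (hinc (u n) s hs.2).trans (mul_le_mul_of_nonneg_left
    (mul_le_mul_of_nonneg_left (hR n) (Real.sqrt_nonneg _)) hC.nonneg)
  have h3 := dist_triangle4 (∫ r in (0 : ℝ)..s, velocity ι u' r (γ r))
    (∫ r in (0 : ℝ)..t, velocity ι u' r (γ r)) (∫ r in (0 : ℝ)..t, velocity ι (u n) r (γ r))
    (∫ r in (0 : ℝ)..s, velocity ι (u n) r (γ r))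
  rw [dist_comm] at hn h2
  have h4 : C * (√|s - t| * ‖u'‖) + C * (√|s - t| * R) < ε / 2 := hs.1
  linarith

/-- Solutions depend continuously on the field in the weak topology. -/
lemma tendsto_solution (hC : HasLipschitzBound ι C) {u : ℕ → L2Field H}
    {u' : L2Field H} {R : ℝ} (hR : ∀ n, ‖u n‖ ≤ R)
    (hu : ∀ L : StrongDual ℝ (L2Field H), Tendsto (fun n => L (u n)) atTop (𝓝 (L u')))
    {γ : ℕ → ℝ → Euc d} {γ' : ℝ → Euc d} (hγ : ∀ n, IsSolution (velocity ι (u n)) (γ n))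
    (hγ' : IsSolution (velocity ι u') γ') (h0 : ∀ n, γ n 0 = γ' 0) {t : ℝ}
    (ht : t ∈ Icc (0 : ℝ) 1) : Tendsto (fun n => γ n t) atTop (𝓝 (γ' t)) := by
  rw [Metric.tendsto_nhds]
  intro ε hε
  have hpos : 0 < ε / (2 * Real.exp (C * R)) := by positivity
  -- The limit curve `γ'` nearly solves the equation of `u n`: the defect is the difference of the
  -- two displacements along `γ'`, and the Grönwall factor is at most `exp (C * R)`.
  filter_upwards [Metric.tendstoUniformlyOn_iff.1
    (hC.tendstoUniformlyOn_integral_velocity hR hu hγ'.1) _ hpos] with n hn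
  have h0m := left_mem_Icc.2 (zero_le_one (α := ℝ))
  have h := (hC.isCaratheodory (u n)).norm_sub_le_of_approx (hγ n) hγ'.1 h0m
    (c := ε / (2 * Real.exp (C * R))) (fun q hq => ?_) ht
  · rw [dist_eq_norm]
    refine h.trans_lt ?_
    calc ε / (2 * Real.exp (C * R)) * Real.exp (∫ r in (0 : ℝ)..1, C * ‖u n r‖)
        ≤ ε / (2 * Real.exp (C * R)) * Real.exp (C * R) := by
          gcongr
          exact (hC.integral_bound_le _).trans (mul_le_mul_of_nonneg_left (hR n) hC.nonneg)
      _ = ε / 2 := by field_simp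
      _ < ε := half_lt_self hε
  · rw [hγ'.2 0 h0m q hq, h0 n, add_sub_add_left_eq_sub, ← dist_eq_norm, dist_comm]
    exact (hn q hq).le

end HasLipschitzBound

/-- Bounded sequences in a Hilbert space have weakly convergent subsequences. -/
lemma exists_weakly_tendsto_subseq {K : Type*} [NormedAddCommGroup K] [InnerProductSpace ℝ K]
    [CompleteSpace K] {u : ℕ → K} {R : ℝ} (hR : ∀ n, ‖u n‖ ≤ R) :
    ∃ (u' : K) (φ : ℕ → ℕ), StrictMono φ ∧
      ∀ L : StrongDual ℝ K, Tendsto (fun n => L (u (φ n))) atTop (𝓝 (L u')) := by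
  -- The closed span of the sequence is separable, so weak-* sequential compactness of balls in its
  -- dual applies, and Riesz representation carries the limit back.
  set V : Submodule ℝ K := (Submodule.span ℝ (range u)).topologicalClosure
  have : CompleteSpace V := (Submodule.isClosed_topologicalClosure _).completeSpace_coe
  have : TopologicalSpace.SeparableSpace V :=
    (((countable_range u).isSeparable.span (R := ℝ)).closure).separableSpace
  have hmem : ∀ n, u n ∈ V := fun n =>
    Submodule.le_topologicalClosure _ (Submodule.subset_span (mem_range_self n))
  let f : ℕ → WeakDual ℝ V := fun n =>
    StrongDual.toWeakDual (InnerProductSpace.toDual ℝ V ⟨u n, hmem n⟩)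
  have hf : ∀ n, f n ∈ WeakDual.toStrongDual ⁻¹' Metric.closedBall (0 : StrongDual ℝ V) R := by
    intro n
    rw [mem_preimage, Metric.mem_closedBall]
    exact ((dist_zero_right (InnerProductSpace.toDual ℝ V ⟨u n, hmem n⟩)).trans
      (LinearIsometryEquiv.norm_map (InnerProductSpace.toDual ℝ V) _)).trans_le (hR n)
  obtain ⟨g, -, φ, hφ, hlim⟩ := WeakDual.isSeqCompact_closedBall ℝ V 0 R hf
  set v : V := (InnerProductSpace.toDual ℝ V).symm (WeakDual.toStrongDual g)
  refine ⟨v, φ, hφ, fun L => ?_⟩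
  set w : V := (InnerProductSpace.toDual ℝ V).symm (L.comp V.subtypeL)
  have hL : ∀ z : V, L z = inner ℝ z w := fun z => by
    rw [real_inner_comm, InnerProductSpace.toDual_symm_apply]
    rfl
  have h1 : Tendsto (fun n => f (φ n) w) atTop (𝓝 (g w)) :=
    ((WeakDual.eval_continuous w).tendsto g).comp hlim
  have h2 : L v = g w := by
    rw [hL, InnerProductSpace.toDual_symm_apply]
    rfl
  rw [h2]
  refine h1.congr fun n => ?_
  exact (hL ⟨u (φ n), hmem _⟩).symm

/-- Test the weak convergence against `u'` itself and use `2ab ≤ a² + b²`. -/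
lemma norm_sq_le_of_weakly_tendsto {K : Type*} [NormedAddCommGroup K] [InnerProductSpace ℝ K]
    {u : ℕ → K} {u' : K}
    (hu : ∀ L : StrongDual ℝ K, Tendsto (fun n => L (u n)) atTop (𝓝 (L u'))) {ε : ℝ}
    (hε : 0 < ε) : ∀ᶠ n in atTop, ‖u'‖ ^ 2 ≤ ‖u n‖ ^ 2 + ε := by
  have h := hu (innerSL ℝ u')
  simp only [innerSL_apply_apply, real_inner_self_eq_norm_sq] at h
  filter_upwards [h.eventually_const_lt (show ‖u'‖ ^ 2 - ε / 2 < ‖u'‖ ^ 2 by linarith)] with n hn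
  nlinarith [real_inner_le_norm u' (u n), sq_nonneg (‖u'‖ - ‖u n‖)]

end LDDMM

/-! ### The flow on `ℝ^d`, its inverse, and the flow on `Ω`. -/

namespace LDDMM

variable {d : ℕ} {Ω : Set (Euc d)} {H : Type*} [NormedAddCommGroup H] [InnerProductSpace ℝ H]
  {ι : H →ₗ[ℝ] C10 Ω} {C : ℝ}

namespace HasLipschitzBound

/-- The flow of `u` on all of `ℝ^d`. -/
noncomputable def globalFlow (hC : HasLipschitzBound ι C) (u : L2Field H) (t : ℝ) (x : Euc d) :
    Euc d :=
  ((hC.isCaratheodory u).exists_isSolution_zero x).choose t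

/-- The inverse of the time-one map of the flow of `u` on all of `ℝ^d`. -/
noncomputable def globalFlowInv (hC : HasLipschitzBound ι C) (u : L2Field H) (y : Euc d) : Euc d :=
  ((hC.isCaratheodory u).exists_isSolution_one y).choose 0

lemma isSolution_globalFlow (hC : HasLipschitzBound ι C) (u : L2Field H) (x : Euc d) :
    IsSolution (velocity ι u) fun t => hC.globalFlow u t x :=
  ((hC.isCaratheodory u).exists_isSolution_zero x).choose_spec.1

lemma globalFlow_zero (hC : HasLipschitzBound ι C) (u : L2Field H) (x : Euc d) :
    hC.globalFlow u 0 x = x :=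
  ((hC.isCaratheodory u).exists_isSolution_zero x).choose_spec.2

lemma globalFlow_one_globalFlowInv (hC : HasLipschitzBound ι C) (u : L2Field H) (y : Euc d) :
    hC.globalFlow u 1 (hC.globalFlowInv u y) = y := by
  obtain ⟨h1, h2⟩ := ((hC.isCaratheodory u).exists_isSolution_one y).choose_spec
  exact (hC.eq_of_eq (hC.isSolution_globalFlow u _) h1 (left_mem_Icc.2 zero_le_one)
    (right_mem_Icc.2 zero_le_one) (hC.globalFlow_zero u _)).trans h2

lemma globalFlowInv_globalFlow_one (hC : HasLipschitzBound ι C) (u : L2Field H) (x : Euc d) :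
    hC.globalFlowInv u (hC.globalFlow u 1 x) = x := by
  have h := hC.eq_of_eq (hC.isSolution_globalFlow u (hC.globalFlowInv u (hC.globalFlow u 1 x)))
    (hC.isSolution_globalFlow u x) (right_mem_Icc.2 zero_le_one) (left_mem_Icc.2 zero_le_one)
    (hC.globalFlow_one_globalFlowInv u _)
  simpa only [globalFlow_zero] using h

lemma lipschitzWith_globalFlow_one (hC : HasLipschitzBound ι C) (u : L2Field H) :
    LipschitzWith (Real.exp (C * ‖u‖)).toNNReal (hC.globalFlow u 1) :=
  LipschitzWith.of_dist_le_mul fun x y => by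
    have := hC.norm_sub_le_exp_mul (hC.isSolution_globalFlow u x) (hC.isSolution_globalFlow u y)
      (left_mem_Icc.2 zero_le_one) (right_mem_Icc.2 zero_le_one)
    simpa only [globalFlow_zero, dist_eq_norm, Real.coe_toNNReal _ (Real.exp_pos _).le] using this

lemma lipschitzWith_globalFlowInv (hC : HasLipschitzBound ι C) (u : L2Field H) :
    LipschitzWith (Real.exp (C * ‖u‖)).toNNReal (hC.globalFlowInv u) :=
  LipschitzWith.of_dist_le_mul fun x y => by
    have := hC.norm_sub_le_exp_mul (hC.isSolution_globalFlow u (hC.globalFlowInv u x))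
      (hC.isSolution_globalFlow u (hC.globalFlowInv u y))
      (right_mem_Icc.2 zero_le_one) (left_mem_Icc.2 zero_le_one)
    simpa only [globalFlow_zero, globalFlow_one_globalFlowInv, dist_eq_norm,
      Real.coe_toNNReal _ (Real.exp_pos _).le] using this

lemma globalFlow_one_mem_iff (hC : HasLipschitzBound ι C) (u : L2Field H) (x : Euc d) :
    hC.globalFlow u 1 x ∈ Ω ↔ x ∈ Ω := by
  have h1 := hC.mem_of_mem (hC.isSolution_globalFlow u x) (left_mem_Icc.2 zero_le_one)
    (right_mem_Icc.2 zero_le_one)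
  have h2 := hC.mem_of_mem (hC.isSolution_globalFlow u x) (right_mem_Icc.2 zero_le_one)
    (left_mem_Icc.2 zero_le_one)
  rw [globalFlow_zero] at h1 h2
  exact ⟨h2, h1⟩

lemma globalFlowInv_mem_iff (hC : HasLipschitzBound ι C) (u : L2Field H) (y : Euc d) :
    hC.globalFlowInv u y ∈ Ω ↔ y ∈ Ω := by
  rw [← hC.globalFlow_one_mem_iff u, globalFlow_one_globalFlowInv]

lemma isFlow_globalFlow (hC : HasLipschitzBound ι C) (u : L2Field H) :
    IsFlow Ω ι u (hC.globalFlow u) := by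
  intro x hx
  have hsol := hC.isSolution_globalFlow u x
  have h0 := left_mem_Icc.2 (zero_le_one (α := ℝ))
  refine ⟨hsol.1, (hC.isCaratheodory u).intervalIntegrable hsol.1 h0
    (right_mem_Icc.2 zero_le_one), fun t ht => ⟨?_, ?_⟩⟩
  · refine hC.mem_of_mem hsol h0 ht ?_
    rwa [globalFlow_zero]
  · have := hsol.2 0 h0 t ht
    simp only [globalFlow_zero] at this
    exact this

lemma eq_globalFlow_of_isFlow (hC : HasLipschitzBound ι C) {u : L2Field H}
    {φ : ℝ → Euc d → Euc d} (hφ : IsFlow Ω ι u φ) {t : ℝ} (ht : t ∈ Icc (0 : ℝ) 1) {x : Euc d}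
    (hx : x ∈ Ω) : φ t x = hC.globalFlow u t x := by
  have h0 := left_mem_Icc.2 (zero_le_one (α := ℝ))
  obtain ⟨hc, -, heq⟩ := hφ x hx
  refine hC.eq_of_eq ((hC.isCaratheodory u).isSolution_of_forall_eq hc fun t ht => (heq t ht).2)
    (hC.isSolution_globalFlow u x) h0 ht ?_
  rw [globalFlow_zero, (heq 0 h0).2]
  simp

lemma isFlow_flow (hC : HasLipschitzBound ι C) (u : L2Field H) : IsFlow Ω ι u (flow Ω ι u) := by
  have h : ∃ φ, IsFlow Ω ι u φ := ⟨_, hC.isFlow_globalFlow u⟩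
  rw [flow, dif_pos h]
  exact h.choose_spec

lemma flow_eq_globalFlow (hC : HasLipschitzBound ι C) (u : L2Field H) {t : ℝ}
    (ht : t ∈ Icc (0 : ℝ) 1) {x : Euc d} (hx : x ∈ Ω) :
    flow Ω ι u t x = hC.globalFlow u t x :=
  hC.eq_globalFlow_of_isFlow (hC.isFlow_flow u) ht hx

lemma bijOn_flow_one (hC : HasLipschitzBound ι C) (u : L2Field H) :
    BijOn (flow Ω ι u 1) Ω Ω := by
  have h : BijOn (hC.globalFlow u 1) Ω Ω :=
    BijOn.mk (fun x hx => (hC.globalFlow_one_mem_iff u x).2 hx)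
      (Function.LeftInverse.injective (hC.globalFlowInv_globalFlow_one u)).injOn
      fun y hy => ⟨_, (hC.globalFlowInv_mem_iff u y).2 hy, hC.globalFlow_one_globalFlowInv u y⟩
  exact h.congr fun x hx => (hC.flow_eq_globalFlow u (right_mem_Icc.2 zero_le_one) hx).symm

lemma flowInv_eq_globalFlowInv (hC : HasLipschitzBound ι C) (u : L2Field H) {y : Euc d}
    (hy : y ∈ Ω) : flowInv Ω ι u y = hC.globalFlowInv u y := by
  have hbij := hC.bijOn_flow_one u
  have hmem := (hC.globalFlowInv_mem_iff u y).2 hy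
  have h1 : flow Ω ι u 1 (hC.globalFlowInv u y) = y := by
    rw [hC.flow_eq_globalFlow u (right_mem_Icc.2 zero_le_one) hmem, globalFlow_one_globalFlowInv]
  have hex : ∃ x ∈ Ω, flow Ω ι u 1 x = y := ⟨_, hmem, h1⟩
  exact hbij.injOn (Function.invFunOn_mem hex) hmem ((Function.invFunOn_eq hex).trans h1.symm)

/-- Weak convergence of fields implies pointwise convergence of the inverse time-one maps. -/
lemma tendsto_globalFlowInv (hC : HasLipschitzBound ι C) {u : ℕ → L2Field H}
    {u' : L2Field H} {R : ℝ} (hR : ∀ n, ‖u n‖ ≤ R)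
    (hu : ∀ L : StrongDual ℝ (L2Field H), Tendsto (fun n => L (u n)) atTop (𝓝 (L u')))
    (y : Euc d) :
    Tendsto (fun n => hC.globalFlowInv (u n) y) atTop (𝓝 (hC.globalFlowInv u' y)) := by
  set x := hC.globalFlowInv u' y with hx
  have h1 : Tendsto (fun n => hC.globalFlow (u n) 1 x) atTop (𝓝 y) := by
    have := hC.tendsto_solution hR hu (fun n => hC.isSolution_globalFlow (u n) x)
      (hC.isSolution_globalFlow u' x) (fun n => by simp only [globalFlow_zero])
      (right_mem_Icc.2 zero_le_one)
    rwa [hx, globalFlow_one_globalFlowInv] at this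
  rw [tendsto_iff_dist_tendsto_zero] at h1 ⊢
  have h2 := h1.const_mul (Real.exp (C * R))
  rw [mul_zero] at h2
  refine squeeze_zero (fun _ => dist_nonneg) (fun n => ?_) h2
  -- Since `x` is the inverse image of its own time-`1` position under `u n`, the uniform Lipschitz
  -- bound on the inverse maps reduces the claim to forward convergence.
  have h3 := (hC.lipschitzWith_globalFlowInv (u n)).dist_le_mul y (hC.globalFlow (u n) 1 x)
  rw [globalFlowInv_globalFlow_one, Real.coe_toNNReal _ (Real.exp_pos _).le, dist_comm y] at h3
  refine h3.trans ?_
  gcongr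
  exacts [hC.nonneg, hR n]

end HasLipschitzBound

/-! ### Volume distortion and semicontinuity of the misfit. -/

section ChangeOfVariables

/-- Lebesgue measure is a multiple of `d`-dimensional Hausdorff measure, for which the bound is
immediate; the multiple cancels. -/
lemma volume_image_le_of_lipschitzWith {K : NNReal} {f : Euc d → Euc d} (hf : LipschitzWith K f)
    (s : Set (Euc d)) : volume (f '' s) ≤ (K : ENNReal) ^ d * volume s := by
  have h := hf.hausdorffMeasure_image_le (Nat.cast_nonneg d) s
  obtain ⟨c, hvol⟩ : ∃ c : NNReal, (volume : Measure (Euc d)) = c • Measure.hausdorffMeasure d :=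
    ⟨_, Measure.isAddLeftInvariant_eq_smul volume (Measure.hausdorffMeasure d)⟩
  simp only [hvol, Measure.smul_apply, ENNReal.smul_def, smul_eq_mul]
  rw [mul_left_comm]
  rw [ENNReal.rpow_natCast] at h
  exact mul_le_mul_right h _

lemma map_volume_le_of_lipschitzWith {K : NNReal} {f g : Euc d → Euc d} (hf : LipschitzWith K f)
    (hg : Measurable g) (hfg : Function.LeftInverse f g) (hgf : Function.LeftInverse g f) :
    Measure.map g volume ≤ ((K : ENNReal) ^ d) • (volume : Measure (Euc d)) := by
  refine Measure.le_iff.2 fun s hs => ?_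
  rw [Measure.map_apply hg hs, ← image_eq_preimage_of_inverse hgf hfg]
  exact volume_image_le_of_lipschitzWith hf s

end ChangeOfVariables

namespace HasLipschitzBound

lemma map_globalFlowInv_le (hC : HasLipschitzBound ι C) {u : L2Field H} {R : ℝ} (hR : ‖u‖ ≤ R) :
    Measure.map (hC.globalFlowInv u) volume
      ≤ ((Real.exp (C * R)).toNNReal ^ d : ENNReal) • (volume : Measure (Euc d)) := by
  refine map_volume_le_of_lipschitzWith ((hC.lipschitzWith_globalFlow_one u).weaken ?_)
    (hC.lipschitzWith_globalFlowInv u).continuous.measurable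
    (hC.globalFlow_one_globalFlowInv u) (hC.globalFlowInv_globalFlow_one u)
  have := hC.nonneg
  gcongr

lemma quasiMeasurePreserving_globalFlowInv (hC : HasLipschitzBound ι C) (u : L2Field H) :
    Measure.QuasiMeasurePreserving (hC.globalFlowInv u) volume volume :=
  ⟨(hC.lipschitzWith_globalFlowInv u).continuous.measurable,
    (Measure.absolutelyContinuous_of_le (hC.map_globalFlowInv_le le_rfl)).trans
      (Measure.smul_absolutelyContinuous)⟩

lemma eLpNorm_comp_globalFlowInv_le (hC : HasLipschitzBound ι C) {u : L2Field H} {R : ℝ}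
    (hR : ‖u‖ ≤ R) {f : Euc d → ℝ} (hf : AEStronglyMeasurable f volume) :
    eLpNorm (fun x => f (hC.globalFlowInv u x)) 2 volume
      ≤ ((Real.exp (C * R)).toNNReal ^ d : ENNReal) ^ (1 / 2 : ℝ) * eLpNorm f 2 volume := by
  have hq := hC.quasiMeasurePreserving_globalFlowInv u
  rw [show (fun x => f (hC.globalFlowInv u x)) = f ∘ hC.globalFlowInv u from rfl,
    ← eLpNorm_map_measure (hf.mono_ac hq.absolutelyContinuous) hq.measurable.aemeasurable]
  refine (eLpNorm_mono_measure f (hC.map_globalFlowInv_le hR)).trans (le_of_eq ?_)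
  rw [eLpNorm_smul_measure_of_ne_top (by simp)]
  simp

lemma comp_globalFlowInv_memLp (hC : HasLipschitzBound ι C) (u : L2Field H) {f : Euc d → ℝ}
    (hf : MemLp f 2 volume) : MemLp (fun x => f (hC.globalFlowInv u x)) 2 volume := by
  refine ⟨hf.1.comp_quasiMeasurePreserving (hC.quasiMeasurePreserving_globalFlowInv u), ?_⟩
  refine (hC.eLpNorm_comp_globalFlowInv_le le_rfl hf.1).trans_lt (ENNReal.mul_lt_top ?_ hf.2)
  exact ENNReal.rpow_lt_top_of_nonneg (by norm_num) (by finiteness)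

/-- The image misfit is lower semicontinuous along weakly convergent sequences of fields. -/
lemma eventually_misfit_le (hC : HasLipschitzBound ι C) {u : ℕ → L2Field H}
    {u' : L2Field H} {R : ℝ} (hR : ∀ n, ‖u n‖ ≤ R) (hR' : ‖u'‖ ≤ R)
    (hu : ∀ L : StrongDual ℝ (L2Field H), Tendsto (fun n => L (u n)) atTop (𝓝 (L u')))
    {f I : Euc d → ℝ} (hf : MemLp f 2 volume) (hI : MemLp I 2 (volume.restrict Ω))
    {ε : ENNReal} (hε : ε ≠ 0) :
    ∀ᶠ n in atTop,
      eLpNorm (fun x => f (hC.globalFlowInv u' x) - I x) 2 (volume.restrict Ω)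
        ≤ eLpNorm (fun x => f (hC.globalFlowInv (u n) x) - I x) 2 (volume.restrict Ω) + ε := by
  set κ : ENNReal := ((Real.exp (C * R)).toNNReal ^ d : ENNReal) ^ (1 / 2 : ℝ)
  have hκ : κ ≠ ⊤ := (ENNReal.rpow_lt_top_of_nonneg (by norm_num) (by finiteness)).ne
  have hε3 : ε / 3 ≠ 0 := (ENNReal.div_pos hε (by finiteness)).ne'
  -- Composition with an inverse flow costs at most the factor `κ`, hence the tolerance `ε / 3 / κ`.
  obtain ⟨g, hg, hgL⟩ := hf.exists_boundedContinuous_eLpNorm_sub_le (by finiteness)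
    (ENNReal.div_pos hε3 hκ).ne'
  have hfg : MemLp (f - ⇑g) 2 volume := hf.sub hgL
  have hclose : ∀ w : L2Field H, ‖w‖ ≤ R →
      eLpNorm (fun x => (f - ⇑g) (hC.globalFlowInv w x)) 2 (volume.restrict Ω) ≤ ε / 3 := by
    intro w hw
    refine (eLpNorm_restrict_le _ _ _ _).trans
      ((hC.eLpNorm_comp_globalFlowInv_le hw hfg.1).trans ?_)
    exact (mul_le_mul_right hg κ).trans ENNReal.mul_div_le
  have hmeas : ∀ (w : L2Field H) {k : Euc d → ℝ}, MemLp k 2 volume →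
      MemLp (fun x => k (hC.globalFlowInv w x)) 2 (volume.restrict Ω) :=
    fun w k hk => (hC.comp_globalFlowInv_memLp w hk).restrict Ω
  have hup : ∀ n, eLpNorm (fun x => g (hC.globalFlowInv (u n) x) - I x) 2 (volume.restrict Ω)
      ≤ eLpNorm (fun x => f (hC.globalFlowInv (u n) x) - I x) 2 (volume.restrict Ω) + ε / 3 := by
    intro n
    refine le_trans (le_of_eq ?_) ((eLpNorm_sub_le ((hmeas (u n) hf).sub hI).1
      (hmeas (u n) hfg).1 one_le_two).trans (add_le_add_right (hclose _ (hR n)) _))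
    congr 1
    ext x
    simp
  have hdown : eLpNorm (fun x => f (hC.globalFlowInv u' x) - I x) 2 (volume.restrict Ω)
      ≤ eLpNorm (fun x => g (hC.globalFlowInv u' x) - I x) 2 (volume.restrict Ω) + ε / 3 := by
    refine le_trans (le_of_eq ?_) ((eLpNorm_add_le ((hmeas u' hgL).sub hI).1
      (hmeas u' hfg).1 one_le_two).trans (add_le_add_right (hclose _ hR') _))
    congr 1
    ext x
    simp
  -- Fatou's lemma needs only pointwise convergence, so `Ω` may have infinite measure.
  have hliminf := Lp.eLpNorm_lim_le_liminf_eLpNorm (p := 2)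
    (fun n => ((hmeas (u n) hgL).sub hI).1) (fun x => g (hC.globalFlowInv u' x) - I x)
    (ae_of_all _ fun x => ((g.continuous.tendsto _).comp
      (hC.tendsto_globalFlowInv hR hu x)).sub_const (I x))
  have hev : ∀ᶠ n in atTop,
      eLpNorm (fun x => g (hC.globalFlowInv u' x) - I x) 2 (volume.restrict Ω)
        ≤ eLpNorm (fun x => g (hC.globalFlowInv (u n) x) - I x) 2 (volume.restrict Ω)
          + ε / 3 := by
    rcases eq_or_ne (eLpNorm (fun x => g (hC.globalFlowInv u' x) - I x) 2 (volume.restrict Ω)) 0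
      with h0 | h0
    · exact Eventually.of_forall fun n => by rw [h0]; exact zero_le
    · have hlt := ENNReal.sub_lt_self ((hmeas u' hgL).sub hI).2.ne h0 hε3
      filter_upwards [eventually_lt_of_lt_liminf (hlt.trans_le hliminf)] with n hn
      exact tsub_le_iff_right.1 hn.le
  filter_upwards [hev] with n hn
  calc _ ≤ _ := hdown
    _ ≤ _ := add_le_add_left (hn.trans (add_le_add_left (hup n) _)) _
    _ = _ := by rw [add_assoc, add_assoc, ← add_assoc (ε / 3), ENNReal.add_thirds]

end HasLipschitzBound

end LDDMM

/-! ### Semicontinuity of the energy and existence of a minimizer. -/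

namespace LDDMM

variable {d : ℕ} {Ω : Set (Euc d)} {H : Type*} [NormedAddCommGroup H] [InnerProductSpace ℝ H]
  {ι : H →ₗ[ℝ] C10 Ω} {C : ℝ}

lemma integral_norm_sq_eq (u : L2Field H) : ∫ t in (0 : ℝ)..1, ‖u t‖ ^ 2 = ‖u‖ ^ 2 := by
  rw [← real_inner_self_eq_norm_sq, L2.inner_def,
    intervalIntegral.integral_of_le zero_le_one, ← integral_Icc_eq_integral_Ioc]
  simp_rw [real_inner_self_eq_norm_sq]

namespace HasLipschitzBound

/-- Extension of the image by zero moves the problem to `ℝ^d`, where the global change of variables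
and density of continuous functions apply. -/
lemma comp_globalFlowInv_ae_eq (hC : HasLipschitzBound ι C) (hΩ : MeasurableSet Ω)
    (u : L2Field H) (I : Euc d → ℝ) :
    (fun x => I (flowInv Ω ι u x)) =ᵐ[volume.restrict Ω]
      fun x => Ω.indicator I (hC.globalFlowInv u x) := by
  filter_upwards [ae_restrict_mem hΩ] with x hx
  rw [hC.flowInv_eq_globalFlowInv u hx, indicator_of_mem ((hC.globalFlowInv_mem_iff u x).2 hx)]

lemma memLp_comp_flowInv (hC : HasLipschitzBound ι C) (hΩ : MeasurableSet Ω) (u : L2Field H)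
    {I : Euc d → ℝ} (hI : MemLp I 2 (volume.restrict Ω)) :
    MemLp (fun x => I (flowInv Ω ι u x)) 2 (volume.restrict Ω) :=
  ((hC.comp_globalFlowInv_memLp u ((memLp_indicator_iff_restrict hΩ).2 hI)).restrict Ω).ae_eq
    (hC.comp_globalFlowInv_ae_eq hΩ u I).symm

lemma comp_flowInv_congr_ae (hC : HasLipschitzBound ι C) (hΩ : MeasurableSet Ω) (u : L2Field H)
    {I J : Euc d → ℝ} (h : J =ᵐ[volume.restrict Ω] I) :
    (fun x => J (flowInv Ω ι u x)) =ᵐ[volume.restrict Ω] fun x => I (flowInv Ω ι u x) := by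
  have h1 := (hC.quasiMeasurePreserving_globalFlowInv u).ae ((ae_restrict_iff' hΩ).1 h)
  refine (ae_restrict_iff' hΩ).2 ?_
  filter_upwards [h1] with x hx hxΩ
  rw [hC.flowInv_eq_globalFlowInv u hxΩ]
  exact hx ((hC.globalFlowInv_mem_iff u x).2 hxΩ)

lemma energy_eq (hC : HasLipschitzBound ι C) (hΩ : MeasurableSet Ω) (σ : ℝ) (I₀ I₁ : Euc d → ℝ)
    (u : L2Field H) : energy Ω ι σ I₀ I₁ u = 1 / 2 * ‖u‖ ^ 2 + 1 / (2 * σ ^ 2) *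
      (eLpNorm (fun x => Ω.indicator I₀ (hC.globalFlowInv u x) - I₁ x) 2
        (volume.restrict Ω)).toReal ^ 2 := by
  rw [energy, integral_norm_sq_eq]
  congr 4
  refine eLpNorm_congr_ae ?_
  filter_upwards [hC.comp_globalFlowInv_ae_eq hΩ u I₀] with x hx
  rw [hx]

/-- The energy is weakly sequentially lower semicontinuous. -/
lemma eventually_energy_le (hC : HasLipschitzBound ι C) (hΩ : MeasurableSet Ω) {σ : ℝ}
    {I₀ I₁ : Euc d → ℝ} (hI₀ : MemLp I₀ 2 (volume.restrict Ω))
    (hI₁ : MemLp I₁ 2 (volume.restrict Ω)) {u : ℕ → L2Field H} {u' : L2Field H} {R : ℝ}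
    (hR : ∀ n, ‖u n‖ ≤ R)
    (hu : ∀ L : StrongDual ℝ (L2Field H), Tendsto (fun n => L (u n)) atTop (𝓝 (L u')))
    {ε : ℝ} (hε : 0 < ε) :
    ∀ᶠ n in atTop, energy Ω ι σ I₀ I₁ u' ≤ energy Ω ι σ I₀ I₁ (u n) + ε := by
  have hf : MemLp (Ω.indicator I₀) 2 volume := (memLp_indicator_iff_restrict hΩ).2 hI₀
  set m : L2Field H → ENNReal := fun w =>
    eLpNorm (fun x => Ω.indicator I₀ (hC.globalFlowInv w x) - I₁ x) 2 (volume.restrict Ω) with hm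
  have hfin : ∀ w, m w ≠ ⊤ := fun w =>
    (((hC.comp_globalFlowInv_memLp w hf).restrict Ω).sub hI₁).2.ne
  have hsq : ∀ {δ : ℝ}, 0 < δ → ∀ᶠ n in atTop, (m u').toReal ^ 2 ≤ (m (u n)).toReal ^ 2 + δ := by
    intro δ hδ
    have h0 : 0 ≤ (m u').toReal := ENNReal.toReal_nonneg
    -- If `a ≤ b + η` with `a, b ≥ 0`, then `a² ≤ b² + 2aη`; the `+ 1` keeps the denominator
    -- positive when the limiting misfit vanishes.
    set η := δ / (2 * (m u').toReal + 1) with hη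
    have hη0 : 0 < η := by positivity
    have hηδ : 2 * (m u').toReal * η ≤ δ := by
      have : η * (2 * (m u').toReal + 1) = δ := by rw [hη]; field_simp
      nlinarith
    filter_upwards [hC.eventually_misfit_le (R := max R ‖u'‖)
      (fun n => (hR n).trans (le_max_left _ _)) (le_max_right _ _) hu hf hI₁
      (ENNReal.ofReal_pos.2 hη0).ne'] with n hn
    have h1 := ENNReal.toReal_mono (by finiteness [hfin (u n)]) hn
    rw [ENNReal.toReal_add (hfin (u n)) ENNReal.ofReal_ne_top, ENNReal.toReal_ofReal hη0.le] at h1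
    have h2 : (m u').toReal ≤ (m (u n)).toReal + η := h1
    have h3 : 0 ≤ (m (u n)).toReal := ENNReal.toReal_nonneg
    nlinarith [sq_nonneg ((m u').toReal - (m (u n)).toReal)]
  set c := 1 / (2 * σ ^ 2) with hc
  have hc0 : 0 ≤ c := by positivity
  filter_upwards [norm_sq_le_of_weakly_tendsto hu hε,
    hsq (δ := ε / (2 * (c + 1))) (by positivity)] with n h1 h2
  have h3 : c * (ε / (2 * (c + 1))) ≤ ε / 2 := by
    rw [← mul_div_assoc, div_le_div_iff₀ (by positivity) two_pos]
    nlinarith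
  rw [hC.energy_eq hΩ, hC.energy_eq hΩ]
  change 1 / 2 * ‖u'‖ ^ 2 + c * (m u').toReal ^ 2
    ≤ 1 / 2 * ‖u n‖ ^ 2 + c * (m (u n)).toReal ^ 2 + ε
  have h4 := mul_le_mul_of_nonneg_left h2 hc0
  rw [mul_add] at h4
  linarith

lemma exists_energy_le [CompleteSpace H] (hC : HasLipschitzBound ι C) (hΩ : MeasurableSet Ω)
    (σ : ℝ) {I₀ I₁ : Euc d → ℝ} (hI₀ : MemLp I₀ 2 (volume.restrict Ω))
    (hI₁ : MemLp I₁ 2 (volume.restrict Ω)) :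
    ∃ u' : L2Field H, ∀ u, energy Ω ι σ I₀ I₁ u' ≤ energy Ω ι σ I₀ I₁ u := by
  have hnorm : ∀ u, 1 / 2 * ‖u‖ ^ 2 ≤ energy Ω ι σ I₀ I₁ u := fun u => by
    rw [hC.energy_eq hΩ]
    exact le_add_of_nonneg_right (by positivity)
  have hbdd : BddBelow (range fun u : L2Field H => energy Ω ι σ I₀ I₁ u) :=
    ⟨0, by rintro _ ⟨u, rfl⟩; exact le_trans (by positivity) (hnorm u)⟩
  set m := ⨅ u : L2Field H, energy Ω ι σ I₀ I₁ u
  have hseq : ∀ n : ℕ, ∃ u : L2Field H, energy Ω ι σ I₀ I₁ u < m + 1 / (n + 1) := fun n =>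
    exists_lt_of_ciInf_lt (lt_add_of_pos_right m Nat.one_div_pos_of_nat)
  choose u hu using hseq
  -- Half the squared norm is at most the energy, which is below `m + 1` along the sequence.
  have hR : ∀ n, ‖u n‖ ≤ √(2 * (m + 1)) := fun n => by
    have h1 : (1 : ℝ) / (n + 1) ≤ 1 := by
      rw [div_le_one (by positivity)]
      linarith [n.cast_nonneg (α := ℝ)]
    exact Real.le_sqrt_of_sq_le (by linarith [hnorm (u n), hu n])
  obtain ⟨u', φ, hφ, hlim⟩ := exists_weakly_tendsto_subseq hR
  refine ⟨u', fun w => le_trans (le_of_forall_pos_le_add fun ε hε => ?_) (ciInf_le hbdd w)⟩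
  have h1 : ∀ᶠ n : ℕ in atTop, (1 : ℝ) / ((φ n : ℝ) + 1) < ε / 2 :=
    (tendsto_one_div_add_atTop_nhds_zero_nat.comp hφ.tendsto_atTop).eventually_lt_const
      (half_pos hε)
  obtain ⟨n, hn1, hn2⟩ := (h1.and (hC.eventually_energy_le hΩ (σ := σ) hI₀ hI₁
    (fun n => hR (φ n)) hlim (half_pos hε))).exists
  linarith [hu (φ n)]

end HasLipschitzBound

end LDDMM

theorem mainTheorem5 {d : ℕ} (Ω : Set (LDDMM.Euc d)) (hΩ : IsOpen Ω)
    {H : Type*} [NormedAddCommGroup H] [InnerProductSpace ℝ H] [CompleteSpace H]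
    (ι : H →ₗ[ℝ] LDDMM.C10 Ω) (hι : LDDMM.IsAdmissible Ω ι)
    (σ : ℝ) (hσ : σ ≠ 0) (I₀ I₁ : LDDMM.Euc d → ℝ)
    (hI₀ : MemLp I₀ 2 (volume.restrict Ω)) (hI₁ : MemLp I₁ 2 (volume.restrict Ω)) :
    -- the energy is well defined: the flow exists and is unique, `φ₁` is a bijection of `Ω`,
    -- and `I₀ ∘ φ₁⁻¹` is a well-defined element of `L²(Ω)`
    (∀ u : LDDMM.L2Field H,
      LDDMM.IsFlow Ω ι u (LDDMM.flow Ω ι u) ∧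
      (∀ φ, LDDMM.IsFlow Ω ι u φ →
        ∀ t ∈ Icc (0 : ℝ) 1, ∀ x ∈ Ω, φ t x = LDDMM.flow Ω ι u t x) ∧
      BijOn (LDDMM.flow Ω ι u 1) Ω Ω ∧
      MemLp (fun x => I₀ (LDDMM.flowInv Ω ι u x)) 2 (volume.restrict Ω) ∧
      (∀ J₀ : LDDMM.Euc d → ℝ, J₀ =ᵐ[volume.restrict Ω] I₀ →
        (fun x => J₀ (LDDMM.flowInv Ω ι u x)) =ᵐ[volume.restrict Ω]
          fun x => I₀ (LDDMM.flowInv Ω ι u x))) ∧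
    -- the energy has a minimizer
    ∃ u' : LDDMM.L2Field H,
      (∀ u : LDDMM.L2Field H, LDDMM.energy Ω ι σ I₀ I₁ u' ≤ LDDMM.energy Ω ι σ I₀ I₁ u) ∧
      LDDMM.energy Ω ι σ I₀ I₁ u' = ⨅ u : LDDMM.L2Field H, LDDMM.energy Ω ι σ I₀ I₁ u := by
  have hm := hΩ.measurableSet
  obtain ⟨C, hC⟩ := hι.exists_hasLipschitzBound hΩ
  refine ⟨fun u => ⟨hC.isFlow_flow u, fun φ hφ t ht x hx => ?_, hC.bijOn_flow_one u,
    hC.memLp_comp_flowInv hm u hI₀, fun J₀ hJ => hC.comp_flowInv_congr_ae hm u hJ⟩, ?_⟩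
  · rw [hC.flow_eq_globalFlow u ht hx, hC.eq_globalFlow_of_isFlow hφ ht hx]
  · obtain ⟨u', hu'⟩ := hC.exists_energy_le hm σ hI₀ hI₁
    -- The minimal value itself is the lower bound that a real infimum requires.
    refine ⟨u', hu', le_antisymm (le_ciInf hu') (ciInf_le ⟨LDDMM.energy Ω ι σ I₀ I₁ u', ?_⟩ u')⟩
    rintro _ ⟨u, rfl⟩
    exact hu' u
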